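/- **Theorem.** Consider $k$ anonymous stations on a shared channel with synchronous rounds $0,1,2,\dots$, where initially all stations sleep. An adaptive adversary decides online, at the end of each round and knowing the whole history so far (which stations transmitted in which rounds up to and including the current one) but not the future randomness, which sleeping stations are activated in that round; each station is activated at most once. The activation round is round $0$ of the station's local clock. From local round $1$ on, an activated station runs the protocol $\mathtt{SublinearDecrease}(b)$, where $b\ge 1$ is an integer: for $j=3,4,5,\dots$ in turn, for $b$ consecutive rounds, it transmits with probability $\frac{\ln j}{j}$, independently over rounds and stations. A station transmits successfully in a round if it is the only station transmitting in that round; it then gets an acknowledgement and immediately switches off permanently (there is no other feedback). For every $\eta>0$ there is $b_0\ge 1$ such that for every integer $b\ge b_0$ there is a constant $C>0$, depending only on $\eta$ and $b$, such that for every $k\ge 3$ and every strategy of the adaptive adversary, with probability at least $1-k^{-\eta}$ every activated station transmits successfully within $$C\cdot \frac{k\,\ln^2 k}{\ln\ln k}$$ rounds after its activation. -/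

import Mathlib

open MeasureTheory

namespace ContentionResolution

/-- The probability with which a station running `SublinearDecrease(b)` transmits in round `i` of
its local clock. Local round `0` is the activation round, in which nothing is transmitted. Local
rounds `1, …, b` form the block `j = 3`, the next `b` local rounds the block `j = 4`, and so on;
in block `j` the probability is `ln j / j`. -/
noncomputable def transmitProb (b i : ℕ) : ℝ :=
  if i = 0 then 0 else
    let j : ℕ := 3 + (i - 1) / b
    Real.log j / j

/-- A strategy of the adaptive adversary for `k` stations. Its argument is the computation history
up to and including the current round `t`: the list of the sets of transmitting stations in rounds
`t, t - 1, …, 0` (most recent first). Its value is the set of stations that the adversary activates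
in round `t` (stations that were activated before are not affected). The earlier activations, the
successes and the round number are functions of this list and of the strategy, so this
is the whole history. -/
abbrev Adversary (k : ℕ) : Type := List (Finset (Fin k)) → Finset (Fin k)

/-- The state of the system between two rounds. -/
structure State (k : ℕ) where
  /-- The sets of transmitting stations in the rounds so far, most recent first. -/
  history : List (Finset (Fin k))
  /-- The round of the reference clock in which a station was activated, if it was. -/
  wake : Fin k → Option ℕ
  /-- The round of the reference clock in which a station transmitted successfully, if it did;
  the station is switched off from then on. -/
  success : Fin k → Option ℕ

/-- At the beginning all stations are sleeping. -/
def State.init (k : ℕ) : State k where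
  history := []
  wake := fun _ => none
  success := fun _ => none

/-- The probability with which station `v` transmits in round `t` of the reference clock, when `s`
is the state just before that round: `transmitProb b (t - w)` if `v` was activated in
round `w` and has not yet succeeded, and `0` if it sleeps or is switched off. -/
noncomputable def State.stationProb {k : ℕ} (b : ℕ) (s : State k) (t : ℕ) (v : Fin k) : ℝ :=
  match s.wake v, s.success v with
  | some w, none => transmitProb b (t - w)
  | _, _ => 0

open Classical in
/-- The stations that transmit in round `t`. Here `u v` is a fresh uniform random number in `[0, 1]`
and `v` transmits iff `u v` is below its current transmission probability. -/
noncomputable def State.transmitters {k : ℕ} (b : ℕ) (s : State k) (t : ℕ)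
    (u : Fin k → unitInterval) : Finset (Fin k) :=
  Finset.univ.filter fun v => (u v : ℝ) < s.stationProb b t v

/-- Round `t`: the active stations toss their coins; if exactly one station transmits, it succeeds
and (by the acknowledgement) switches off; the adversary, who has seen the outcome of this round,
activates some of the sleeping stations, which start transmitting in round `t + 1`. -/
noncomputable def State.step {k : ℕ} (b : ℕ) (adv : Adversary k) (t : ℕ) (s : State k)
    (u : Fin k → unitInterval) : State k where
  history := s.transmitters b t u :: s.history
  wake := fun v =>
    if s.wake v = none ∧ v ∈ adv (s.transmitters b t u :: s.history) then some t else s.wake v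
  success := fun v => if s.transmitters b t u = {v} then some t else s.success v

/-- The state just before round `t`, in the execution of `SublinearDecrease(b)` against `adv` in
which the random number of station `v` in round `t` is `ω t v`. -/
noncomputable def run {k : ℕ} (b : ℕ) (adv : Adversary k) (ω : ℕ → Fin k → unitInterval) :
    ℕ → State k
  | 0 => State.init k
  | t + 1 => (run b adv ω t).step b adv t (ω t)

/-- All random numbers `ω t v` are independent and uniformly distributed in `[0, 1]`. -/
noncomputable def coins (k : ℕ) : Measure (ℕ → Fin k → unitInterval) :=
  Measure.infinitePi fun _ : ℕ => Measure.pi fun _ : Fin k => (volume : Measure unitInterval)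

/-- Station `v` is activated in round `w`. -/
def ActivatedAt {k : ℕ} (b : ℕ) (adv : Adversary k) (ω : ℕ → Fin k → unitInterval)
    (v : Fin k) (w : ℕ) : Prop :=
  ∃ t, (run b adv ω t).wake v = some w

/-- Station `v` transmits successfully in round `m`. -/
def SucceedsAt {k : ℕ} (b : ℕ) (adv : Adversary k) (ω : ℕ → Fin k → unitInterval)
    (v : Fin k) (m : ℕ) : Prop :=
  ∃ t, (run b adv ω t).success v = some m

/-- Every station that is ever activated transmits successfully within `L` rounds of its
activation: the latency of the execution is at most `L`. -/
def LatencyAtMost {k : ℕ} (b : ℕ) (adv : Adversary k) (ω : ℕ → Fin k → unitInterval)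
    (L : ℝ) : Prop :=
  ∀ (v : Fin k) (w : ℕ), ActivatedAt b adv ω v w →
    ∃ m : ℕ, SucceedsAt b adv ω v m ∧ (m : ℝ) - (w : ℝ) ≤ L

end ContentionResolution

/-! Let the contention σ of a round be the sum of all transmission probabilities. These are at most
1/2, so a station with probability p succeeds with probability at least p·exp(-2σ), and some station
succeeds with probability at least σ·exp(-2σ). Put Y = k ln² k / ln ln k, take the window of T =
⌊100bY⌋ rounds after an activation, and sort its rounds by σ, for large k.

High, σ > (ln ln k)/2: each station adds O(b ln² k) to the total contention of the window, so there
are at most 24bY such rounds (`card_low_contention`). Moderate, 1 < σ ≤ (ln ln k)/2: each such round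
has a success with probability at least 1/ln k, yet only k successes can ever occur; hence 4k ln k
such rounds in the whole execution have probability at most exp(-k) (`prob_moderate_rounds_le`).
Low, σ ≤ 1: otherwise at least half of the window remains, and there a waiting station has p ≥ b ln
k / (2T). It survives all these rounds with probability at most k^(-η-2) when b ≥ 32(η+2)
(`prob_waits_le`); a union bound over the stations finishes.

Adaptivity is handled by products of factors depending on the current state and the fresh coins,
each of conditional mean at most 1. Their expectation stays at most 1 against every adversary, and
Markov's inequality gives the tail bounds. The finitely many small k are absorbed into C by
`exists_latency_bound`. -/

namespace ContentionResolution

open ProbabilityTheory Filter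
open scoped ENNReal

variable {k : ℕ}

/-! ### Measurability of the execution -/

instance State.instMeasurableSpace : MeasurableSpace (State k) := ⊤

instance State.instDiscreteMeasurableSpace : DiscreteMeasurableSpace (State k) :=
  ⟨fun _ => trivial⟩

/-- Countability lets measurability and conditioning be checked one fixed state at a time. -/
instance State.instCountable : Countable (State k) := by
  have h : Function.Injective
      (fun s : State k => (s.history, s.wake, s.success)) := by
    rintro ⟨a, b, c⟩ ⟨a', b', c'⟩ h
    simp only [Prod.mk.injEq] at h
    obtain ⟨rfl, rfl, rfl⟩ := h
    rfl
  exact h.countable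

/-- The distribution of the random numbers of a single round. -/
noncomputable abbrev roundCoins (k : ℕ) : Measure (Fin k → unitInterval) :=
  Measure.pi fun _ : Fin k => (volume : Measure unitInterval)

instance coins.instIsProbabilityMeasure : IsProbabilityMeasure (coins k) := by
  unfold coins; infer_instance

theorem measurableSet_transmits (c : ℝ) (v : Fin k) :
    MeasurableSet {u : Fin k → unitInterval | (u v : ℝ) < c} :=
  measurableSet_lt (by fun_prop) measurable_const

theorem measurableSet_transmitters_eq (b : ℕ) (s : State k) (t : ℕ) (A : Finset (Fin k)) :
    MeasurableSet {u | s.transmitters b t u = A} := by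
  have : {u | s.transmitters b t u = A} =
      ⋂ v, {u : Fin k → unitInterval | (u v : ℝ) < s.stationProb b t v ↔ v ∈ A} := by
    ext u
    simp [State.transmitters, Finset.ext_iff]
  rw [this]
  refine MeasurableSet.iInter fun v => ?_
  by_cases hv : v ∈ A
  · simpa [hv] using measurableSet_transmits (s.stationProb b t v) v
  · simp only [hv, iff_false]
    exact (measurableSet_transmits (s.stationProb b t v) v).compl

theorem measurable_comp_transmitters {β : Type*} [MeasurableSpace β] (b : ℕ) (s : State k) (t : ℕ)
    (f : Finset (Fin k) → β) : Measurable fun u => f (s.transmitters b t u) := by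
  intro B _
  have : (fun u => f (s.transmitters b t u)) ⁻¹' B =
      ⋃ A ∈ {A | f A ∈ B}, {u | s.transmitters b t u = A} := by
    ext u; simp
  rw [this]
  exact MeasurableSet.biUnion (Set.to_countable _) fun A _ => measurableSet_transmitters_eq b s t A

/-- The events that are determined by the random numbers of the rounds before `t`. -/
@[reducible]
def pastEvents (k t : ℕ) : MeasurableSpace (ℕ → Fin k → unitInterval) :=
  MeasurableSpace.comap (fun ω (i : Finset.range t) => ω i) inferInstance

theorem measurable_pastEvents_eval {i t : ℕ} (h : i < t) :
    Measurable[pastEvents k t] fun ω : ℕ → Fin k → unitInterval => ω i := by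
  have h1 : Measurable[pastEvents k t]
      fun (ω : ℕ → Fin k → unitInterval) (i : Finset.range t) => ω i := comap_measurable _
  exact (measurable_pi_apply (⟨i, Finset.mem_range.2 h⟩ : Finset.range t)).comp h1

theorem pastEvents_le (t : ℕ) : pastEvents k t ≤ MeasurableSpace.pi := by
  refine Measurable.comap_le ?_
  fun_prop

theorem pastEvents_mono {t t' : ℕ} (h : t ≤ t') : pastEvents k t ≤ pastEvents k t' := by
  refine Measurable.comap_le ?_
  refine @measurable_pi_lambda _ _ _ (pastEvents k t') _ _ fun i => ?_
  exact measurable_pastEvents_eval ((Finset.mem_range.1 i.2).trans_le h)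

theorem indep_pastEvents (t : ℕ) :
    Indep (pastEvents k t)
      (MeasurableSpace.comap (fun ω : ℕ → Fin k → unitInterval => ω t) inferInstance)
      (coins k) := by
  have h := iIndepFun_infinitePi (P := fun _ : ℕ => roundCoins k)
    (X := fun _ (u : Fin k → unitInterval) => u) (fun _ => measurable_id)
  have h2 := h.indepFun_finset (Finset.range t) {t} (by simp) (fun i => measurable_pi_apply i)
  have h3 : Measurable fun f : ({t} : Finset ℕ) → Fin k → unitInterval => f ⟨t, by simp⟩ := by
    fun_prop
  exact h2.comp measurable_id h3

theorem measurable_run (b : ℕ) (adv : Adversary k) (t : ℕ) :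
    Measurable[pastEvents k t] fun ω => run b adv ω t := by
  induction t with
  | zero => exact @measurable_const _ _ _ (_) (State.init k)
  | succ t ih =>
    have h1 : Measurable[pastEvents k (t + 1)] fun ω => (run b adv ω t, ω t) :=
      @Measurable.prodMk _ _ _ _ _ (_) _ _ (ih.mono (pastEvents_mono t.le_succ) le_rfl)
        (measurable_pastEvents_eval t.lt_succ_self)
    have h2 : Measurable fun p : State k × (Fin k → unitInterval) => p.1.step b adv t p.2 :=
      measurable_from_prod_countable_right fun s =>
        measurable_comp_transmitters b s t fun A =>
          (⟨A :: s.history,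
            fun v => if s.wake v = none ∧ v ∈ adv (A :: s.history) then some t else s.wake v,
            fun v => if A = {v} then some t else s.success v⟩ : State k)
    exact h2.comp h1

/-! ### Multiplicative supermartingales -/

/-- The product over the rounds before `t` of the factors `m i`, which depend on the state before
round `i` and on the random numbers of this round. -/
noncomputable def weight (b : ℕ) (adv : Adversary k)
    (m : ℕ → State k → (Fin k → unitInterval) → ℝ≥0∞) (ω : ℕ → Fin k → unitInterval) (t : ℕ) :
    ℝ≥0∞ :=
  ∏ i ∈ Finset.range t, m i (run b adv ω i) (ω i)

section Weight

variable {b : ℕ} {adv : Adversary k} {m : ℕ → State k → (Fin k → unitInterval) → ℝ≥0∞}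

theorem measurable_weight (hm : ∀ i s, Measurable (m i s)) (t : ℕ) :
    Measurable[pastEvents k t] fun ω => weight b adv m ω t := by
  unfold weight
  refine @Finset.measurable_fun_prod _ _ _ _ _ _ (pastEvents k t) _ _ fun i hi => ?_
  have hi : i < t := Finset.mem_range.1 hi
  have h1 : Measurable[pastEvents k t] fun ω => (run b adv ω i, ω i) :=
    @Measurable.prodMk _ _ _ _ _ (_) _ _
      ((measurable_run b adv i).mono (pastEvents_mono hi.le) le_rfl)
      (measurable_pastEvents_eval hi)
  have h2 : Measurable fun p : State k × (Fin k → unitInterval) => m i p.1 p.2 :=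
    measurable_from_prod_countable_right fun s => hm i s
  exact h2.comp h1

/-- The state before round `t` is a function of the past and the coins of round `t` are independent
of it, so given the state the new factor has mean at most 1. -/
theorem lintegral_weight_le_one (hm : ∀ i s, Measurable (m i s))
    (hint : ∀ i s, ∫⁻ u, m i s u ∂(roundCoins k) ≤ 1) (t : ℕ) :
    ∫⁻ ω, weight b adv m ω t ∂(coins k) ≤ 1 := by
  induction t with
  | zero => simp [weight]
  | succ t ih =>
    have hset : ∀ s, MeasurableSet[pastEvents k t] {ω | run b adv ω t = s} := fun s =>
      measurable_run b adv t (MeasurableSet.singleton s)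
    let f : State k → (ℕ → Fin k → unitInterval) → ℝ≥0∞ := fun s =>
      Set.indicator {ω | run b adv ω t = s} fun ω => weight b adv m ω t
    have hf : ∀ s, Measurable[pastEvents k t] (f s) := fun s =>
      (measurable_weight hm t).indicator (hset s)
    have hf' : ∀ s, Measurable (f s) := fun s => (hf s).mono (pastEvents_le t) le_rfl
    -- Conditioning on the state is a countable sum in which only the term of the actual state
    -- survives.
    have hsum : ∀ (ω) (g : State k → ℝ≥0∞),
        ∑' s, f s ω * g s = weight b adv m ω t * g (run b adv ω t) := by
      intro ω g
      rw [tsum_eq_single (run b adv ω t)]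
      · simp [f]
      · intro s hs
        simp [f, hs.symm]
    have hmt : ∀ s, Measurable fun ω : ℕ → Fin k → unitInterval => m t s (ω t) := fun s =>
      (hm t s).comp (measurable_pi_apply t)
    calc ∫⁻ ω, weight b adv m ω (t + 1) ∂(coins k)
        = ∫⁻ ω, ∑' s, f s ω * m t s (ω t) ∂(coins k) := by
          refine lintegral_congr fun ω => ?_
          rw [hsum ω fun s => m t s (ω t), weight, Finset.prod_range_succ]
          rfl
      _ = ∑' s, ∫⁻ ω, f s ω * m t s (ω t) ∂(coins k) :=
          lintegral_tsum fun s => ((hf' s).mul (hmt s)).aemeasurable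
      _ ≤ ∑' s, ∫⁻ ω, f s ω ∂(coins k) := by
          refine ENNReal.tsum_le_tsum fun s => ?_
          rw [lintegral_mul_eq_lintegral_mul_lintegral_of_independent_measurableSpace
            (g := fun ω => m t s (ω t)) (pastEvents_le t)
            (Measurable.comap_le (measurable_pi_apply t)) (indep_pastEvents t) (hf s)
            fun B hB => ⟨m t s ⁻¹' B, hm t s hB, rfl⟩]
          refine mul_le_of_le_one_right' ?_
          have : (coins k).map (fun ω => ω t) = roundCoins k :=
            Measure.infinitePi_map_eval (fun _ : ℕ => roundCoins k) t
          rw [← lintegral_map (hm t s) (measurable_pi_apply t), this]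
          exact hint t s
      _ = ∫⁻ ω, ∑' s, f s ω * 1 ∂(coins k) := by
          simp_rw [mul_one]
          exact (lintegral_tsum fun s => (hf' s).aemeasurable).symm
      _ ≤ 1 := by
          simp_rw [hsum _ fun _ => 1, mul_one]
          exact ih

/-- Activation rounds are unbounded, so no fixed horizon suffices: Fatou's lemma bounds the mean of
the liminf by 1, and Markov's inequality applies to it. -/
theorem measure_eventually_le_weight (hm : ∀ i s, Measurable (m i s))
    (hint : ∀ i s, ∫⁻ u, m i s u ∂(roundCoins k) ≤ 1) (x : ℝ) :
    (coins k).real {ω | ∀ᶠ t in atTop, ENNReal.ofReal (Real.exp x) ≤ weight b adv m ω t} ≤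
      Real.exp (-x) := by
  have hmeas : ∀ t, Measurable fun ω => weight b adv m ω t := fun t =>
    (measurable_weight hm t).mono (pastEvents_le t) le_rfl
  have h1 : ∫⁻ ω, liminf (fun t => weight b adv m ω t) atTop ∂(coins k) ≤ 1 := by
    refine (lintegral_liminf_le hmeas).trans ?_
    refine (liminf_le_liminf (Eventually.of_forall fun t => lintegral_weight_le_one hm hint t)).trans
      ?_
    simp
  have h2 := mul_meas_ge_le_lintegral (μ := coins k) (Measurable.liminf hmeas)
    (ENNReal.ofReal (Real.exp x))
  have h3 : (coins k) {ω | ∀ᶠ t in atTop, ENNReal.ofReal (Real.exp x) ≤ weight b adv m ω t} ≤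
      (coins k) {ω | ENNReal.ofReal (Real.exp x) ≤ liminf (fun t => weight b adv m ω t) atTop} :=
    measure_mono fun ω hω => le_liminf_of_le (by isBoundedDefault) hω
  have h4 : (coins k) {ω | ∀ᶠ t in atTop, ENNReal.ofReal (Real.exp x) ≤ weight b adv m ω t} ≤
      ENNReal.ofReal (Real.exp (-x)) := by
    rw [Real.exp_neg, ENNReal.ofReal_inv_of_pos (Real.exp_pos x), ENNReal.le_inv_iff_mul_le,
      mul_comm]
    exact (mul_le_mul_right h3 _).trans (h2.trans h1)
  exact ENNReal.toReal_le_of_le_ofReal (Real.exp_pos _).le h4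

end Weight

/-! ### Transmission probabilities -/

theorem transmitProb_zero (b : ℕ) : transmitProb b 0 = 0 := by simp [transmitProb]

theorem transmitProb_succ (b i : ℕ) :
    transmitProb b (i + 1) = Real.log ((3 + i / b : ℕ) : ℝ) / ((3 + i / b : ℕ) : ℝ) := by
  simp [transmitProb]

theorem transmitProb_nonneg (b i : ℕ) : 0 ≤ transmitProb b i := by
  cases i with
  | zero => rw [transmitProb_zero]
  | succ i =>
    rw [transmitProb_succ]
    exact div_nonneg (Real.log_natCast_nonneg _) (Nat.cast_nonneg _)

theorem transmitProb_le_half (b i : ℕ) : transmitProb b i ≤ 1 / 2 := by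
  cases i with
  | zero => rw [transmitProb_zero]; norm_num
  | succ i =>
    rw [transmitProb_succ]
    have hpos : (0 : ℝ) < ((3 + i / b : ℕ) : ℝ) := by positivity
    generalize ((3 + i / b : ℕ) : ℝ) = x at hpos
    rw [div_le_iff₀ hpos]
    -- The tangent bound at `x / 2` gives ln x ≤ x/2 - 1 + ln 2 < x/2.
    have h1 := Real.log_le_sub_one_of_pos (half_pos hpos)
    rw [Real.log_div hpos.ne' two_ne_zero] at h1
    linarith [Real.log_two_lt_d9]

theorem transmitProb_succ_anti (b : ℕ) : Antitone fun i => transmitProb b (i + 1) := by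
  intro i j hij
  simp only [transmitProb_succ]
  have h3 : ∀ n : ℕ, ((3 + n : ℕ) : ℝ) ∈ {x : ℝ | Real.exp 1 ≤ x} := fun n => by
    have := Real.exp_one_lt_d9
    simp only [Set.mem_ofPred_eq]
    push_cast
    have : (0 : ℝ) ≤ n := Nat.cast_nonneg n
    linarith
  refine Real.log_div_self_antitoneOn (h3 _) (h3 _) ?_
  exact_mod_cast Nat.add_le_add_left (Nat.div_le_div_right hij) 3

theorem State.stationProb_nonneg (b : ℕ) (s : State k) (t : ℕ) (v : Fin k) :
    0 ≤ s.stationProb b t v := by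
  unfold State.stationProb
  split
  · exact transmitProb_nonneg _ _
  · exact le_rfl

theorem State.stationProb_le_half (b : ℕ) (s : State k) (t : ℕ) (v : Fin k) :
    s.stationProb b t v ≤ 1 / 2 := by
  unfold State.stationProb
  split
  · exact transmitProb_le_half _ _
  · norm_num

theorem State.stationProb_of_active {b : ℕ} {s : State k} {t w : ℕ} {v : Fin k}
    (hw : s.wake v = some w) (hs : s.success v = none) :
    s.stationProb b t v = transmitProb b (t - w) := by
  simp [State.stationProb, hw, hs]

theorem State.stationProb_of_success {b : ℕ} {s : State k} {t : ℕ} {v : Fin k}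
    (hs : s.success v ≠ none) : s.stationProb b t v = 0 := by
  unfold State.stationProb
  split
  · contradiction
  · rfl

/-- The sum of the transmission probabilities of all stations. -/
noncomputable def State.contention (b : ℕ) (s : State k) (t : ℕ) : ℝ :=
  ∑ v, s.stationProb b t v

theorem State.contention_le (b : ℕ) (s : State k) (t : ℕ) : s.contention b t ≤ k := by
  calc s.contention b t ≤ ∑ _v : Fin k, (1 : ℝ) :=
        Finset.sum_le_sum fun v _ => (s.stationProb_le_half b t v).trans (by norm_num)
    _ = k := by simp

/-! ### The probability of a success -/

theorem exp_neg_two_mul_le_one_sub {p : ℝ} (h0 : 0 ≤ p) (h1 : p ≤ 1 / 2) :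
    Real.exp (-(2 * p)) ≤ 1 - p := by
  rw [Real.exp_neg, inv_le_comm₀ (Real.exp_pos _) (by linarith), inv_le_iff_one_le_mul₀
    (by linarith)]
  have := Real.add_one_le_exp (2 * p)
  nlinarith

theorem volume_setOf_lt {c : ℝ} (h0 : 0 ≤ c) (h1 : c ≤ 1) :
    volume {x : unitInterval | (x : ℝ) < c} = ENNReal.ofReal c :=
  unitInterval.volume_Iio ⟨c, h0, h1⟩

theorem volume_setOf_ge {c : ℝ} (h0 : 0 ≤ c) (h1 : c ≤ 1) :
    volume {x : unitInterval | c ≤ (x : ℝ)} = ENNReal.ofReal (1 - c) :=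
  unitInterval.volume_Ici ⟨c, h0, h1⟩

theorem le_prob_transmitters_eq_singleton (b : ℕ) (s : State k) (t : ℕ) (v : Fin k) :
    s.stationProb b t v * Real.exp (-(2 * s.contention b t)) ≤
      (roundCoins k).real {u | s.transmitters b t u = {v}} := by
  classical
  set p := s.stationProb b t with hp
  have hp0 : ∀ w, 0 ≤ p w := s.stationProb_nonneg b t
  have hp1 : ∀ w, p w ≤ 1 / 2 := s.stationProb_le_half b t
  have hset : {u | s.transmitters b t u = {v}} =
      Set.univ.pi fun w => if w = v then {x : unitInterval | (x : ℝ) < p w}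
        else {x : unitInterval | p w ≤ (x : ℝ)} := by
    ext u
    simp only [State.transmitters, Finset.ext_iff, Finset.mem_filter, Finset.mem_univ, true_and,
      Finset.mem_singleton, Set.mem_ofPred_eq, Set.mem_univ_pi]
    refine forall_congr' fun w => ?_
    by_cases h : w = v <;> simp [h, hp]
  have hmeas : (roundCoins k).real {u | s.transmitters b t u = {v}} =
      ∏ w, if w = v then p w else 1 - p w := by
    rw [measureReal_def, hset, Measure.pi_pi, ENNReal.toReal_prod]
    refine Finset.prod_congr rfl fun w _ => ?_
    have h1 : p w ≤ 1 := (hp1 w).trans (by norm_num)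
    split_ifs
    · rw [volume_setOf_lt (hp0 w) h1, ENNReal.toReal_ofReal (hp0 w)]
    · rw [volume_setOf_ge (hp0 w) h1, ENNReal.toReal_ofReal (by linarith)]
  rw [hmeas, ← Finset.mul_prod_erase _ _ (Finset.mem_univ v), if_pos rfl]
  refine mul_le_mul_of_nonneg_left ?_ (hp0 v)
  calc Real.exp (-(2 * s.contention b t))
      ≤ Real.exp (∑ w ∈ Finset.univ.erase v, -(2 * p w)) := by
        rw [Real.exp_le_exp, Finset.sum_neg_distrib, ← Finset.mul_sum, neg_le_neg_iff]
        refine mul_le_mul_of_nonneg_left ?_ zero_le_two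
        exact Finset.sum_le_sum_of_subset_of_nonneg (Finset.subset_univ _) fun w _ _ => hp0 w
    _ = ∏ w ∈ Finset.univ.erase v, Real.exp (-(2 * p w)) := Real.exp_sum _ _
    _ ≤ ∏ w ∈ Finset.univ.erase v, if w = v then p w else 1 - p w := by
        refine Finset.prod_le_prod (fun w _ => (Real.exp_pos _).le) fun w hw => ?_
        rw [if_neg (Finset.ne_of_mem_erase hw)]
        exact exp_neg_two_mul_le_one_sub (hp0 w) (hp1 w)

theorem le_prob_exists_transmitters_eq_singleton (b : ℕ) (s : State k) (t : ℕ) :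
    s.contention b t * Real.exp (-(2 * s.contention b t)) ≤
      (roundCoins k).real {u | ∃ v, s.transmitters b t u = {v}} := by
  have hset : {u | ∃ v, s.transmitters b t u = {v}} = ⋃ v, {u | s.transmitters b t u = {v}} := by
    ext u; simp
  rw [hset, measureReal_iUnion_fintype]
  · conv_lhs => rw [State.contention, Finset.sum_mul]
    exact Finset.sum_le_sum fun v _ => le_prob_transmitters_eq_singleton b s t v
  · intro v w hvw
    refine Set.disjoint_left.2 fun u hu hu' => hvw ?_
    exact Finset.singleton_injective (hu.symm.trans hu')
  · exact fun v => measurableSet_transmitters_eq b s t {v}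

/-- The integral is c₂ - (c₂ - c₁)·μ(P), which decreases in μ(P); hence a lower bound for μ(P) is
enough. -/
theorem lintegral_ite_le_one {Ω : Type*} [MeasurableSpace Ω] (μ : Measure Ω)
    [IsProbabilityMeasure μ] {P : Ω → Prop} [DecidablePred P] (hP : MeasurableSet {u | P u})
    {c₁ c₂ p : ℝ} (h₁ : 0 ≤ c₁) (h₁₂ : c₁ ≤ c₂) (hp : p ≤ μ.real {u | P u})
    (h : c₁ * p + c₂ * (1 - p) ≤ 1) :
    ∫⁻ u, ENNReal.ofReal (if P u then c₁ else c₂) ∂μ ≤ 1 := by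
  have h₂ : 0 ≤ c₂ := h₁.trans h₁₂
  have h0 : ∀ u, 0 ≤ (if P u then c₁ else c₂) := fun u => by split_ifs <;> assumption
  have hm : Measurable fun u => if P u then c₁ else c₂ :=
    Measurable.ite hP measurable_const measurable_const
  have hI : Integrable (fun u => if P u then c₁ else c₂) μ := by
    refine Integrable.of_bound hm.aestronglyMeasurable c₂ (Eventually.of_forall fun u => ?_)
    rw [Real.norm_of_nonneg (h0 u)]
    split_ifs
    · exact h₁₂
    · exact le_rfl
  rw [← ofReal_integral_eq_lintegral_ofReal hI (Eventually.of_forall h0), ENNReal.ofReal_le_one]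
  have heq : (fun u => if P u then c₁ else c₂) =
      fun u => c₂ - {u | P u}.indicator (fun _ => c₂ - c₁) u := by
    ext u
    by_cases hu : P u <;> simp [hu]
  rw [heq, integral_sub (integrable_const _) ((integrable_const _).indicator hP),
    integral_indicator_const _ hP]
  simp only [integral_const, probReal_univ, smul_eq_mul, one_mul]
  nlinarith [mul_le_mul_of_nonneg_right hp (sub_nonneg.2 h₁₂)]

/-! ### Invariants of the execution -/

section Invariants

variable {b : ℕ} {adv : Adversary k} {ω : ℕ → Fin k → unitInterval} {v : Fin k} {t t' w m : ℕ}

theorem wake_succ_of_eq_some (h : (run b adv ω t).wake v = some w) :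
    (run b adv ω (t + 1)).wake v = some w := by
  simp [run, State.step, h]

theorem wake_mono (htt' : t ≤ t') (h : (run b adv ω t).wake v = some w) :
    (run b adv ω t').wake v = some w := by
  induction htt' with
  | refl => exact h
  | step _ ih => exact wake_succ_of_eq_some ih

theorem wake_eq_some_succ (h : (run b adv ω t).wake v = some w) :
    (run b adv ω (w + 1)).wake v = some w := by
  induction t with
  | zero => simp [run, State.init] at h
  | succ t ih =>
    by_cases h' : (run b adv ω t).wake v = some w
    · exact ih h'
    · have : t = w := by
        simp only [run, State.step] at h
        split_ifs at h
        · exact Option.some.inj h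
        · exact absurd h h'
      exact this ▸ h

theorem notMem_transmitters_of_success (h : (run b adv ω t).success v ≠ none)
    (u : Fin k → unitInterval) : v ∉ (run b adv ω t).transmitters b t u := by
  simp only [State.transmitters, Finset.mem_filter, Finset.mem_univ, true_and, not_lt]
  rw [State.stationProb_of_success h]
  exact (u v).2.1

/-- A switched-off station has probability 0 and the coin test is strict, so its recorded success is
never overwritten. -/
theorem success_succ_of_eq_some (h : (run b adv ω t).success v = some m) :
    (run b adv ω (t + 1)).success v = some m := by
  have h1 : (run b adv ω t).transmitters b t (ω t) ≠ {v} := fun h2 =>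
    notMem_transmitters_of_success (by simp [h]) (ω t) (h2 ▸ Finset.mem_singleton_self v)
  simp [run, State.step, h1, h]

theorem success_mono (htt' : t ≤ t') (h : (run b adv ω t).success v = some m) :
    (run b adv ω t').success v = some m := by
  induction htt' with
  | refl => exact h
  | step _ ih => exact success_succ_of_eq_some ih

theorem success_lt (h : (run b adv ω t).success v = some m) : m < t := by
  induction t with
  | zero => simp [run, State.init] at h
  | succ t ih =>
    simp only [run, State.step] at h
    split_ifs at h
    · have := Option.some.inj h
      omega
    · have := ih h
      omega

theorem success_succ_of_transmitters_eq
    (h : (run b adv ω t).transmitters b t (ω t) = {v}) :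
    (run b adv ω (t + 1)).success v = some t := by
  simp [run, State.step, h]

open Classical in
theorem card_success_le (b : ℕ) (adv : Adversary k) (ω : ℕ → Fin k → unitInterval) (t : ℕ) :
    ((Finset.range t).filter fun i => ∃ v, (run b adv ω i).transmitters b i (ω i) = {v}).card ≤
      k := by
  -- Every success round is the recorded round of its station; the default 0 for the other stations
  -- only enlarges the image.
  calc _ ≤ ((Finset.univ : Finset (Fin k)).image
          fun v => ((run b adv ω t).success v).getD 0).card := by
        refine Finset.card_le_card fun i hi => ?_
        obtain ⟨hi, v, hv⟩ := Finset.mem_filter.1 hi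
        have h := success_mono (Nat.succ_le_of_lt (Finset.mem_range.1 hi))
          (success_succ_of_transmitters_eq hv)
        exact Finset.mem_image.2 ⟨v, Finset.mem_univ v, by simp [h]⟩
    _ ≤ (Finset.univ : Finset (Fin k)).card := Finset.card_image_le
    _ = k := by simp

end Invariants

/-! ### Rounds of moderate contention are rare -/

open Classical in
/-- A factor that rewards a round of contention between `1` and `θ` and is reduced by a success. -/
noncomputable def moderateFactor (b : ℕ) (θ : ℝ) (i : ℕ) (s : State k)
    (u : Fin k → unitInterval) : ℝ≥0∞ :=
  ENNReal.ofReal (Real.exp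
    ((if 1 < s.contention b i ∧ s.contention b i ≤ θ then Real.exp (-(2 * θ)) / 2 else 0) -
      if ∃ v, s.transmitters b i u = {v} then 1 else 0))

theorem measurable_moderateFactor (b : ℕ) (θ : ℝ) (i : ℕ) (s : State k) :
    Measurable (moderateFactor b θ i s) := by
  classical
  exact measurable_comp_transmitters b s i fun A => ENNReal.ofReal (Real.exp
    ((if 1 < s.contention b i ∧ s.contention b i ≤ θ then Real.exp (-(2 * θ)) / 2 else 0) -
      if ∃ v, A = {v} then 1 else 0))

theorem lintegral_moderateFactor_le_one (b : ℕ) (θ : ℝ) (i : ℕ) (s : State k) :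
    ∫⁻ u, moderateFactor b θ i s u ∂(roundCoins k) ≤ 1 := by
  classical
  set q := Real.exp (-(2 * θ)) with hq
  have hq0 : 0 < q := Real.exp_pos _
  set x := if 1 < s.contention b i ∧ s.contention b i ≤ θ then q / 2 else 0 with hx
  have hrw : ∀ u, moderateFactor b θ i s u = ENNReal.ofReal
      (if ∃ v, s.transmitters b i u = {v} then Real.exp (x - 1) else Real.exp x) := by
    intro u
    unfold moderateFactor
    rw [← hq, ← hx]
    split_ifs
    · rfl
    · rw [sub_zero]
  simp_rw [hrw]
  have hmeas : MeasurableSet {u | ∃ v, s.transmitters b i u = {v}} := by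
    have : {u | ∃ v, s.transmitters b i u = {v}} = ⋃ v, {u | s.transmitters b i u = {v}} := by
      ext u; simp
    rw [this]
    exact MeasurableSet.iUnion fun v => measurableSet_transmitters_eq b s i {v}
  -- The reward `x` is half of the bound on the success probability. As exp(-1) ≤ 1/2, the mean is
  -- then at most exp(x)·(1 - x) ≤ 1.
  have hp : 2 * x ≤ (roundCoins k).real {u | ∃ v, s.transmitters b i u = {v}} := by
    by_cases h : 1 < s.contention b i ∧ s.contention b i ≤ θ
    · rw [hx, if_pos h]
      refine le_trans ?_ (le_prob_exists_transmitters_eq_singleton b s i)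
      have h1 : q ≤ Real.exp (-(2 * s.contention b i)) := by
        rw [hq, Real.exp_le_exp]; linarith
      nlinarith
    · rw [hx, if_neg h]
      simp
  have hx0 : 0 ≤ x := by rw [hx]; split_ifs <;> positivity
  refine lintegral_ite_le_one _ hmeas (Real.exp_pos _).le (by rw [Real.exp_le_exp]; linarith) hp ?_
  have h1 : Real.exp (x - 1) ≤ Real.exp x / 2 := by
    rw [Real.exp_sub]
    have := Real.exp_one_gt_d9
    gcongr
    linarith
  have h2 : Real.exp x * (1 - x) ≤ 1 := by
    have := Real.one_sub_le_exp_neg x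
    calc Real.exp x * (1 - x) ≤ Real.exp x * Real.exp (-x) := by gcongr
      _ = 1 := by rw [← Real.exp_add]; simp
  nlinarith

/-- The logarithm of the product of the `moderateFactor`s is exp(-2θ)/2 times the number of moderate
rounds, minus the number of successes, which is at most `k`. -/
theorem prob_moderate_rounds_le (b : ℕ) (adv : Adversary k) (θ N : ℝ) :
    (coins k).real {ω | ∃ F : Finset ℕ, N ≤ F.card ∧
      ∀ i ∈ F, 1 < (run b adv ω i).contention b i ∧ (run b adv ω i).contention b i ≤ θ} ≤
      Real.exp (k - Real.exp (-(2 * θ)) / 2 * N) := by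
  classical
  have key := measure_eventually_le_weight (b := b) (adv := adv)
    (measurable_moderateFactor (k := k) b θ) (lintegral_moderateFactor_le_one (k := k) b θ)
    (Real.exp (-(2 * θ)) / 2 * N - k)
  rw [neg_sub] at key
  refine le_trans (measureReal_mono ?_) key
  rintro ω ⟨F, hN, hF⟩
  obtain ⟨n, hn⟩ := F.bddAbove
  refine eventually_atTop.2 ⟨n + 1, fun t ht => ?_⟩
  unfold weight moderateFactor
  rw [← ENNReal.ofReal_prod_of_nonneg fun _ _ => (Real.exp_pos _).le, ← Real.exp_sum]
  refine ENNReal.ofReal_le_ofReal (Real.exp_le_exp.2 ?_)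
  rw [Finset.sum_sub_distrib]
  refine sub_le_sub ?_ ?_
  · calc Real.exp (-(2 * θ)) / 2 * N ≤ Real.exp (-(2 * θ)) / 2 * F.card := by gcongr
      _ = ∑ i ∈ F, if 1 < (run b adv ω i).contention b i ∧ (run b adv ω i).contention b i ≤ θ
            then Real.exp (-(2 * θ)) / 2 else 0 := by
          rw [Finset.sum_congr rfl fun i hi => if_pos (hF i hi), Finset.sum_const, nsmul_eq_mul,
            mul_comm]
      _ ≤ _ := by
          refine Finset.sum_le_sum_of_subset_of_nonneg (fun i hi => ?_) fun i _ _ => ?_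
          · have : i ≤ n := hn hi
            exact Finset.mem_range.2 (by omega)
          · split_ifs <;> positivity
  · rw [Finset.sum_boole]
    exact_mod_cast card_success_le b adv ω t

/-! ### The waiting time of a single station -/

open Classical in
/-- A factor that vanishes if `v` succeeds in a round of contention at most `θ` within `T` rounds
of its activation, and rewards such rounds otherwise. -/
noncomputable def waitingFactor (b : ℕ) (v : Fin k) (θ : ℝ) (T i : ℕ) (s : State k)
    (u : Fin k → unitInterval) : ℝ≥0∞ :=
  if (∃ w, s.wake v = some w ∧ i ≤ w + T) ∧ s.contention b i ≤ θ then
    ENNReal.ofReal (if s.transmitters b i u = {v} then 0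
      else Real.exp (s.stationProb b i v * Real.exp (-(2 * θ))))
  else 1

theorem measurable_waitingFactor (b : ℕ) (v : Fin k) (θ : ℝ) (T i : ℕ) (s : State k) :
    Measurable (waitingFactor b v θ T i s) := by
  classical
  exact measurable_comp_transmitters b s i fun A =>
    if (∃ w, s.wake v = some w ∧ i ≤ w + T) ∧ s.contention b i ≤ θ then
      ENNReal.ofReal (if A = {v} then 0
        else Real.exp (s.stationProb b i v * Real.exp (-(2 * θ))))
    else 1

theorem lintegral_waitingFactor_le_one (b : ℕ) (v : Fin k) (θ : ℝ) (T i : ℕ) (s : State k) :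
    ∫⁻ u, waitingFactor b v θ T i s u ∂(roundCoins k) ≤ 1 := by
  classical
  unfold waitingFactor
  split_ifs with h
  · have hp : s.stationProb b i v * Real.exp (-(2 * θ)) ≤
        (roundCoins k).real {u | s.transmitters b i u = {v}} := by
      refine le_trans ?_ (le_prob_transmitters_eq_singleton b s i v)
      refine mul_le_mul_of_nonneg_left ?_ (s.stationProb_nonneg b i v)
      rw [Real.exp_le_exp]
      linarith [h.2]
    refine lintegral_ite_le_one _ (measurableSet_transmitters_eq b s i {v}) le_rfl
      (Real.exp_pos _).le hp ?_
    generalize s.stationProb b i v * Real.exp (-(2 * θ)) = x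
    have := Real.one_sub_le_exp_neg x
    calc 0 * x + Real.exp x * (1 - x) = Real.exp x * (1 - x) := by ring
      _ ≤ Real.exp x * Real.exp (-x) := by gcongr
      _ = 1 := by rw [← Real.exp_add]; simp
  · simp

/-- Station `v` is activated in round `w` and does not succeed in the next `T` rounds. -/
def Waits (b : ℕ) (adv : Adversary k) (ω : ℕ → Fin k → unitInterval) (v : Fin k) (w T : ℕ) :
    Prop :=
  ActivatedAt b adv ω v w ∧ ∀ m, SucceedsAt b adv ω v m → w + T < m

section Waits

variable {b : ℕ} {adv : Adversary k} {ω : ℕ → Fin k → unitInterval} {v : Fin k} {i w T : ℕ}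

theorem Waits.wake_eq (h : Waits b adv ω v w T) (hi : w < i) :
    (run b adv ω i).wake v = some w := by
  obtain ⟨t, ht⟩ := h.1
  exact wake_mono hi (wake_eq_some_succ ht)

theorem Waits.success_eq (h : Waits b adv ω v w T) (hi : i ≤ w + T + 1) :
    (run b adv ω i).success v = none := by
  by_contra hne
  obtain ⟨m, hm⟩ := Option.ne_none_iff_exists'.1 hne
  have h1 := h.2 m ⟨i, hm⟩
  have h2 := success_lt hm
  omega

theorem Waits.transmitters_ne (h : Waits b adv ω v w T) (hi : i ≤ w + T) :
    (run b adv ω i).transmitters b i (ω i) ≠ {v} := fun heq => by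
  have h1 := h.2 i ⟨i + 1, success_succ_of_transmitters_eq heq⟩
  omega

theorem Waits.stationProb_eq (h : Waits b adv ω v w T) (hi : w < i) (hi' : i ≤ w + T) :
    (run b adv ω i).stationProb b i v = transmitProb b (i - w) :=
  State.stationProb_of_active (h.wake_eq hi) (h.success_eq (by omega))

end Waits

-- While `v` waits, every factor is at least 1, and each low-contention round in its window
-- contributes its reward. The state records the activation round, so a single product serves all
-- `w` without a union bound over them.
open Classical in
theorem prob_waits_le (b : ℕ) (adv : Adversary k) (v : Fin k) (θ : ℝ) (T : ℕ) (x : ℝ) :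
    (coins k).real {ω | ∃ w, Waits b adv ω v w T ∧
      x ≤ ∑ i ∈ (Finset.Ioc w (w + T)).filter fun i => (run b adv ω i).contention b i ≤ θ,
        transmitProb b (i - w) * Real.exp (-(2 * θ))} ≤ Real.exp (-x) := by
  refine le_trans (measureReal_mono ?_) (measure_eventually_le_weight (b := b) (adv := adv)
    (measurable_waitingFactor b v θ T) (lintegral_waitingFactor_le_one b v θ T) x)
  rintro ω ⟨w, hW, hx⟩
  refine eventually_atTop.2 ⟨w + T + 1, fun t ht => ?_⟩
  let G := (Finset.Ioc w (w + T)).filter fun i => (run b adv ω i).contention b i ≤ θ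
  have hG : G ⊆ Finset.range t := fun i hi => by
    have := Finset.mem_Ioc.1 (Finset.mem_filter.1 hi).1
    exact Finset.mem_range.2 (by omega)
  have hone : ∀ i, 1 ≤ waitingFactor b v θ T i (run b adv ω i) (ω i) := by
    intro i
    unfold waitingFactor
    split_ifs with h1 h2
    · obtain ⟨⟨w', hw', hi⟩, -⟩ := h1
      have hww : w' = w := by
        have h3 := hW.wake_eq (i := max i (w + 1)) (by omega)
        have h4 := wake_mono (le_max_left i (w + 1)) hw'
        exact Option.some.inj (h4.symm.trans h3)
      exact absurd h2 (hW.transmitters_ne (by omega))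
    · rw [ENNReal.one_le_ofReal, Real.one_le_exp_iff]
      exact mul_nonneg (State.stationProb_nonneg _ _ _ _) (Real.exp_pos _).le
    · exact le_rfl
  calc ENNReal.ofReal (Real.exp x)
      ≤ ENNReal.ofReal (Real.exp (∑ i ∈ G, transmitProb b (i - w) * Real.exp (-(2 * θ)))) :=
        ENNReal.ofReal_le_ofReal (Real.exp_le_exp.2 hx)
    _ = ∏ i ∈ G, ENNReal.ofReal (Real.exp (transmitProb b (i - w) * Real.exp (-(2 * θ)))) := by
        rw [Real.exp_sum, ENNReal.ofReal_prod_of_nonneg fun _ _ => (Real.exp_pos _).le]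
    _ = ∏ i ∈ G, waitingFactor b v θ T i (run b adv ω i) (ω i) := by
        refine Finset.prod_congr rfl fun i hi => ?_
        obtain ⟨hi, hθ⟩ := Finset.mem_filter.1 hi
        obtain ⟨hi1, hi2⟩ := Finset.mem_Ioc.1 hi
        unfold waitingFactor
        rw [if_pos ⟨⟨w, hW.wake_eq hi1, hi2⟩, hθ⟩, if_neg (hW.transmitters_ne hi2),
          hW.stationProb_eq hi1 hi2]
    _ ≤ weight b adv (waitingFactor b v θ T) ω t :=
        Finset.prod_le_prod_of_subset_of_one_le' hG fun i _ _ => hone i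

/-! ### The total contention in a window -/

/-- Truncated subtraction sends the rounds before activation to local round 0, where `f` vanishes;
what remains is an initial segment of the right-hand sum. -/
theorem sum_range_shift_le {f : ℕ → ℝ} (h0 : f 0 = 0) (hf : ∀ i, 0 ≤ f i) (n d : ℕ) :
    ∑ i ∈ Finset.range n, f (i + 1 - d) ≤ ∑ i ∈ Finset.range n, f (i + 1) := by
  induction d generalizing n with
  | zero => simp
  | succ d ih =>
    cases n with
    | zero => simp
    | succ n =>
      rw [Finset.sum_range_succ', show 0 + 1 - (d + 1) = 0 by omega, h0, add_zero]
      simp only [Nat.add_sub_add_right]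
      exact (ih n).trans (Finset.sum_le_sum_of_subset_of_nonneg
        (Finset.range_mono n.le_succ) fun i _ _ => hf _)

/-- The worst case is a station activated in round `w`: an earlier activation gives later, smaller
probabilities, and a later one gives fewer terms. -/
theorem sum_stationProb_le (b : ℕ) (adv : Adversary k) (ω : ℕ → Fin k → unitInterval) (w T : ℕ)
    (v : Fin k) :
    ∑ i ∈ Finset.range T, (run b adv ω (w + 1 + i)).stationProb b (w + 1 + i) v ≤
      ∑ i ∈ Finset.range T, transmitProb b (i + 1) := by
  cases hw : (run b adv ω (w + T)).wake v with
  | none =>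
    have h : ∀ i ∈ Finset.range T,
        (run b adv ω (w + 1 + i)).stationProb b (w + 1 + i) v = 0 := by
      intro i hi
      have hi := Finset.mem_range.1 hi
      have : (run b adv ω (w + 1 + i)).wake v = none := by
        by_contra hne
        obtain ⟨a, ha⟩ := Option.ne_none_iff_exists'.1 hne
        have := wake_mono (show w + 1 + i ≤ w + T by omega) ha
        simp [hw] at this
      simp [State.stationProb, this]
    rw [Finset.sum_congr rfl h, Finset.sum_const_zero]
    exact Finset.sum_nonneg fun i _ => transmitProb_nonneg _ _
  | some a =>
    have h : ∀ i ∈ Finset.range T,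
        (run b adv ω (w + 1 + i)).stationProb b (w + 1 + i) v ≤
          transmitProb b (w + 1 + i - a) := by
      intro i hi
      have hi := Finset.mem_range.1 hi
      unfold State.stationProb
      split
      · rename_i a' ha' _
        have := wake_mono (show w + 1 + i ≤ w + T by omega) ha'
        have : a = a' := Option.some.inj (hw.symm.trans this)
        rw [this]
      · exact transmitProb_nonneg _ _
    refine (Finset.sum_le_sum h).trans ?_
    rcases le_total a w with haw | haw
    · refine Finset.sum_le_sum fun i _ => ?_
      have : w + 1 + i - a = (i + (w - a)) + 1 := by omega
      rw [this]
      exact transmitProb_succ_anti b (Nat.le_add_right i _)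
    · refine le_trans (le_of_eq ?_) (sum_range_shift_le (transmitProb_zero b)
        (transmitProb_nonneg b) T (a - w))
      refine Finset.sum_congr rfl fun i _ => ?_
      congr 1
      omega

theorem sum_contention_le (b : ℕ) (adv : Adversary k) (ω : ℕ → Fin k → unitInterval) (w T : ℕ) :
    ∑ i ∈ Finset.Ioc w (w + T), (run b adv ω i).contention b i ≤
      k * ∑ i ∈ Finset.range T, transmitProb b (i + 1) := by
  have : Finset.Ioc w (w + T) = Finset.Ico (w + 1) (w + 1 + T) := by
    ext i; simp only [Finset.mem_Ioc, Finset.mem_Ico]; omega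
  rw [this, Finset.sum_Ico_eq_sum_range, Nat.add_sub_cancel_left]
  unfold State.contention
  rw [Finset.sum_comm]
  refine (Finset.sum_le_sum fun v _ => sum_stationProb_le b adv ω w T v).trans ?_
  simp

/-! ### Sums of transmission probabilities -/

theorem succ_le_mul_three_add_div {b : ℕ} (hb : 1 ≤ b) (i : ℕ) : i + 1 ≤ b * (3 + i / b) := by
  have := Nat.lt_mul_div_succ i (show 0 < b by omega)
  nlinarith

/-- In local round i + 1 the block index is at least (i + 1)/b, so the sum is at most b·ln(3 + T)
times a harmonic sum. -/
theorem sum_transmitProb_le {b : ℕ} (hb : 1 ≤ b) (T : ℕ) :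
    ∑ i ∈ Finset.range T, transmitProb b (i + 1) ≤
      b * Real.log (3 + T) * (1 + Real.log T) := by
  have hlog : 0 ≤ Real.log (3 + T) := Real.log_nonneg (by
    have : (0 : ℝ) ≤ T := Nat.cast_nonneg T
    linarith)
  have hterm : ∀ i ∈ Finset.range T,
      transmitProb b (i + 1) ≤ b * Real.log (3 + T) * ((i + 1 : ℕ) : ℝ)⁻¹ := by
    intro i hi
    have hi := Finset.mem_range.1 hi
    rw [transmitProb_succ]
    have h1 : Real.log ((3 + i / b : ℕ) : ℝ) ≤ Real.log (3 + T) := by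
      refine Real.log_le_log (by positivity) ?_
      have : 3 + i / b ≤ 3 + T := by
        have := Nat.div_le_self i b
        omega
      exact_mod_cast this
    have h2 : (((3 + i / b : ℕ) : ℝ))⁻¹ ≤ b * ((i + 1 : ℕ) : ℝ)⁻¹ := by
      rw [← div_eq_mul_inv, inv_eq_one_div, div_le_div_iff₀ (by positivity) (by positivity),
        one_mul]
      exact_mod_cast succ_le_mul_three_add_div hb i
    calc _ ≤ Real.log (3 + T) * (b * ((i + 1 : ℕ) : ℝ)⁻¹) := by
          rw [div_eq_mul_inv]
          exact mul_le_mul h1 h2 (by positivity) hlog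
      _ = _ := by ring
  refine (Finset.sum_le_sum hterm).trans ?_
  rw [← Finset.mul_sum]
  refine mul_le_mul_of_nonneg_left ?_ (by positivity)
  have := harmonic_le_one_add_log T
  rw [harmonic] at this
  push_cast at this ⊢
  exact this

theorem tendsto_sum_transmitProb (b : ℕ) :
    Tendsto (fun T => ∑ i ∈ Finset.range T, transmitProb b (i + 1)) atTop atTop := by
  have h1 : Tendsto (fun T => ∑ i ∈ Finset.range T, 1 / ((i : ℝ) + 3)) atTop atTop := by
    have h2 : ¬ Summable fun i : ℕ => 1 / ((i : ℝ) + 3) := by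
      have := (summable_nat_add_iff (f := fun n : ℕ => 1 / (n : ℝ)) 3).not.2
        Real.not_summable_one_div_natCast
      simpa using this
    exact (not_summable_iff_tendsto_nat_atTop_of_nonneg fun i => by positivity).1 h2
  refine tendsto_atTop_mono (fun T => Finset.sum_le_sum fun i _ => ?_) h1
  rw [transmitProb_succ]
  have h3 : ((3 + i / b : ℕ) : ℝ) ≤ (i : ℝ) + 3 := by
    have := Nat.div_le_self i b
    exact_mod_cast (show 3 + i / b ≤ i + 3 by omega)
  have h4 : 1 ≤ Real.log ((3 + i / b : ℕ) : ℝ) := by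
    rw [Real.le_log_iff_exp_le (by positivity)]
    have := Real.exp_one_lt_d9
    push_cast
    have : (0 : ℝ) ≤ ((i / b : ℕ) : ℝ) := Nat.cast_nonneg _
    linarith
  gcongr

/-! ### Bounds on the latency -/

theorem one_sub_le_prob_latencyAtMost (b : ℕ) (adv : Adversary k) {T : ℕ} {L : ℝ} (hT : T ≤ L)
    (E : Set (ℕ → Fin k → unitInterval)) (D : Fin k → Set (ℕ → Fin k → unitInterval)) {x y : ℝ}
    (hD : ∀ ω v w, Waits b adv ω v w T → ω ∈ E ∨ ω ∈ D v)
    (hx : (coins k).real E ≤ x) (hy : ∀ v, (coins k).real (D v) ≤ y) :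
    1 - (x + k * y) ≤ (coins k).real {ω | LatencyAtMost b adv ω L} := by
  have hcover : (Set.univ : Set (ℕ → Fin k → unitInterval)) ⊆
      {ω | LatencyAtMost b adv ω L} ∪ (E ∪ ⋃ v, D v) := by
    intro ω _
    by_contra hω
    simp only [Set.mem_union, Set.mem_iUnion, not_or, not_exists] at hω
    obtain ⟨hL, hE, hDv⟩ := hω
    refine hL fun v w hvw => ?_
    by_contra hm
    push Not at hm
    have hW : Waits b adv ω v w T := by
      refine ⟨hvw, fun m hsm => ?_⟩
      have := hm m hsm
      have h2 : ((w + T : ℕ) : ℝ) < m := by push_cast; linarith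
      exact_mod_cast h2
    exact (hD ω v w hW).elim hE (hDv v)
  have h1 : (1 : ℝ) ≤ _ := probReal_univ.symm.le.trans
    ((measureReal_mono hcover (measure_ne_top (coins k) _)).trans
      ((measureReal_union_le _ _).trans (add_le_add_right (measureReal_union_le _ _) _)))
  have h2 : (coins k).real (⋃ v, D v) ≤ k * y :=
    (measureReal_iUnion_fintype_le D).trans
      ((Finset.sum_le_sum fun v _ => hy v).trans (by simp))
  linarith

/-- For a fixed number of stations, some latency bound holds with the required probability. -/
theorem exists_latency_bound (b : ℕ) (η : ℝ) (hk : 1 ≤ k) :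
    ∃ T : ℕ, ∀ L : ℝ, T ≤ L → ∀ adv : Adversary k,
      1 - 1 / (k : ℝ) ^ η ≤ (coins k).real {ω | LatencyAtMost b adv ω L} := by
  classical
  have hk0 : (0 : ℝ) < k := by exact_mod_cast hk
  -- Contention never exceeds `k`, so with θ = k every round counts as low. Divergence of the sum
  -- yields a `T` for which each station fails with probability at most k^(-η-1).
  obtain ⟨T, hT⟩ := ((tendsto_sum_transmitProb b).atTop_mul_const
    (Real.exp_pos (-(2 * (k : ℝ))))).eventually_ge_atTop ((η + 1) * Real.log k) |>.exists
  refine ⟨T, fun L hL adv => ?_⟩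
  have hD : ∀ ω v w, Waits b adv ω v w T → ω ∈ (∅ : Set (ℕ → Fin k → unitInterval)) ∨
      ω ∈ {ω | ∃ w, Waits b adv ω v w T ∧ (η + 1) * Real.log k ≤
        ∑ i ∈ (Finset.Ioc w (w + T)).filter fun i => (run b adv ω i).contention b i ≤ k,
          transmitProb b (i - w) * Real.exp (-(2 * (k : ℝ)))} := by
    intro ω v w hW
    refine Or.inr ⟨w, hW, hT.trans ?_⟩
    rw [Finset.filter_true_of_mem fun i _ => State.contention_le _ _ _, ← Finset.sum_mul]
    have : Finset.Ioc w (w + T) = Finset.Ico (w + 1) (w + 1 + T) := by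
      ext i; simp only [Finset.mem_Ioc, Finset.mem_Ico]; omega
    rw [this, Finset.sum_Ico_eq_sum_range, Nat.add_sub_cancel_left]
    refine mul_le_mul_of_nonneg_right (le_of_eq ?_) (Real.exp_pos _).le
    refine Finset.sum_congr rfl fun i _ => ?_
    congr 1
    omega
  have := one_sub_le_prob_latencyAtMost b adv hL ∅ _ hD (x := 0) (by simp)
    fun v => prob_waits_le b adv v k T _
  refine le_trans (le_of_eq ?_) this
  rw [zero_add, Real.rpow_def_of_pos hk0, one_div, ← Real.exp_neg]
  conv_rhs => rw [← Real.exp_log hk0, ← Real.exp_add, Real.log_exp]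
  congr 2
  ring

-- High rounds number at most the total contention divided by `θ`, and moderate ones fewer than `N`;
-- the rest of the window is low.
open Classical in
theorem card_low_contention (b : ℕ) (adv : Adversary k) (ω : ℕ → Fin k → unitInterval) (w T : ℕ)
    {θ N : ℝ} (hθ : 0 < θ)
    (hN : ∀ F : Finset ℕ, (∀ i ∈ F, 1 < (run b adv ω i).contention b i ∧
      (run b adv ω i).contention b i ≤ θ) → (F.card : ℝ) < N) :
    T - N - k * (∑ i ∈ Finset.range T, transmitProb b (i + 1)) / θ ≤
      (((Finset.Ioc w (w + T)).filter fun i => (run b adv ω i).contention b i ≤ 1).card : ℝ) := by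
  set σ : ℕ → ℝ := fun i => (run b adv ω i).contention b i with hσ
  set I := Finset.Ioc w (w + T) with hI
  let G := I.filter fun i => σ i ≤ 1
  let M := I.filter fun i => 1 < σ i ∧ σ i ≤ θ
  let H := I.filter fun i => θ < σ i
  have hcover : I ⊆ G ∪ (M ∪ H) := by
    intro i hi
    simp only [G, M, H, Finset.mem_union, Finset.mem_filter, hi, true_and]
    rcases le_or_gt (σ i) 1 with h1 | h1
    · exact Or.inl h1
    · rcases le_or_gt (σ i) θ with h2 | h2
      · exact Or.inr (Or.inl ⟨h1, h2⟩)
      · exact Or.inr (Or.inr h2)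
  have hcard : (T : ℝ) ≤ G.card + (M.card + H.card) := by
    have h1 := (Finset.card_le_card hcover).trans
      ((Finset.card_union_le _ _).trans (Nat.add_le_add_left (Finset.card_union_le _ _) _))
    rw [hI, Nat.card_Ioc, Nat.add_sub_cancel_left] at h1
    exact_mod_cast h1
  have hM : (M.card : ℝ) < N := hN M fun i hi => (Finset.mem_filter.1 hi).2
  have hH : (H.card : ℝ) ≤ k * (∑ i ∈ Finset.range T, transmitProb b (i + 1)) / θ := by
    rw [le_div_iff₀ hθ]
    calc (H.card : ℝ) * θ = ∑ i ∈ H, θ := by simp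
      _ ≤ ∑ i ∈ H, σ i := Finset.sum_le_sum fun i hi => (Finset.mem_filter.1 hi).2.le
      _ ≤ ∑ i ∈ I, σ i := Finset.sum_le_sum_of_subset_of_nonneg (Finset.filter_subset _ _)
          fun i _ _ => Finset.sum_nonneg fun v _ => State.stationProb_nonneg _ _ _ _
      _ ≤ _ := sum_contention_le b adv ω w T
  change _ ≤ (G.card : ℝ)
  linarith

/-- The expression `k ln² k / ln ln k` of the latency bound. -/
noncomputable def latencyScale (k : ℕ) : ℝ :=
  k * Real.log k ^ 2 / Real.log (Real.log k)

theorem latencyScale_pos (hk : 3 ≤ k) : 0 < latencyScale k := by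
  have h3 : (3 : ℝ) ≤ k := by exact_mod_cast hk
  have h1 : 1 < Real.log k := by
    rw [Real.lt_log_iff_exp_lt (by linarith)]
    linarith [Real.exp_one_lt_d9]
  have := Real.log_pos h1
  unfold latencyScale
  positivity

theorem eventually_parameters (η c : ℝ) :
    ∀ᶠ k : ℕ in atTop, 1 ≤ Real.log (Real.log k) ∧ 1 ≤ Real.log k ∧
      c * (k * Real.log k ^ 2) + 3 ≤ (k : ℝ) ^ 3 ∧
      Real.exp (-(k : ℝ)) ≤ 1 / 2 * (1 / (k : ℝ) ^ η) := by
  have h1 : ∀ᶠ x : ℝ in atTop, 1 ≤ Real.log (Real.log x) :=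
    (Real.tendsto_log_atTop.comp Real.tendsto_log_atTop).eventually_ge_atTop 1
  have h2 : ∀ᶠ x : ℝ in atTop, 1 ≤ Real.log x := Real.tendsto_log_atTop.eventually_ge_atTop 1
  have h3 : ∀ᶠ x : ℝ in atTop, Real.log x ^ 2 ≤ x := by
    filter_upwards [(Real.isLittleO_pow_log_id_atTop (n := 2)).bound one_pos,
      eventually_ge_atTop 0] with x hx hx0
    rw [one_mul, Real.norm_of_nonneg (sq_nonneg _), id, Real.norm_of_nonneg hx0] at hx
    exact hx
  have h4 : ∀ᶠ x : ℝ in atTop, Real.exp (-x) * x ^ η ≤ 1 / 2 := by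
    have := tendsto_rpow_mul_exp_neg_mul_atTop_nhds_zero η 1 one_pos
    filter_upwards [this.eventually_le_const (show (0 : ℝ) < 1 / 2 by norm_num)] with x hx
    rw [mul_comm]
    simpa using hx
  have h5 := h1.and (h2.and (h3.and (h4.and (eventually_ge_atTop (max 3 (|c| + 1))))))
  filter_upwards [tendsto_natCast_atTop_atTop.eventually h5] with k hk
  obtain ⟨k1, k2, k3, k4, k5⟩ := hk
  generalize (k : ℝ) = x at *
  have hx3 : 3 ≤ x := (le_max_left _ _).trans k5
  have hxc : |c| + 1 ≤ x := (le_max_right _ _).trans k5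
  refine ⟨k1, k2, ?_, ?_⟩
  · have h6 : c * (x * Real.log x ^ 2) ≤ |c| * (x * x) := by
      refine mul_le_mul (le_abs_self c) ?_ (by positivity) (abs_nonneg c)
      exact mul_le_mul_of_nonneg_left k3 (by linarith)
    nlinarith [mul_le_mul_of_nonneg_right hxc (mul_self_nonneg x)]
  · rw [mul_one_div, le_div_iff₀ (by positivity)]
    exact k4

theorem prob_latencyAtMost_of_large {b : ℕ} (hb : 1 ≤ b) {η : ℝ} (hbη : 32 * (η + 2) ≤ b)
    (hll : 1 ≤ Real.log (Real.log k)) (hl : 1 ≤ Real.log k)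
    (hpow : 100 * b * (k * Real.log k ^ 2) + 3 ≤ (k : ℝ) ^ 3)
    (hexp : Real.exp (-(k : ℝ)) ≤ 1 / 2 * (1 / (k : ℝ) ^ η)) (adv : Adversary k) {L : ℝ}
    (hL : 100 * b * latencyScale k ≤ L) :
    1 - 1 / (k : ℝ) ^ η ≤ (coins k).real {ω | LatencyAtMost b adv ω L} := by
  classical
  set l := Real.log k with hl_def
  set ll := Real.log l with hll_def
  set Y := latencyScale k with hY_def
  have hb' : (1 : ℝ) ≤ b := by exact_mod_cast hb
  have hk1 : 2 ≤ (k : ℝ) := by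
    have hk : (k : ℝ) ≠ 0 := fun h => by simp [hl_def, h] at hl; linarith
    have hk' : (0 : ℝ) < k := lt_of_le_of_ne (Nat.cast_nonneg k) hk.symm
    have := Real.log_le_sub_one_of_pos hk'
    linarith
  have hk0 : (0 : ℝ) < k := by linarith
  have hlll : ll ≤ l := by
    have := Real.log_le_sub_one_of_pos (show 0 < l by linarith)
    linarith
  have hYeq : Y * ll = k * l ^ 2 := by
    rw [hY_def, latencyScale, div_mul_cancel₀]
    linarith
  have hklY : k * l ≤ Y := by
    rw [hY_def, latencyScale, le_div_iff₀ (by linarith)]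
    nlinarith [mul_le_mul_of_nonneg_left hlll (show 0 ≤ k * l by positivity)]
  have hkY : k ≤ Y := by nlinarith
  have hYpos : 0 < Y := hk0.trans_le hkY
  have hYle : Y ≤ k * l ^ 2 := by nlinarith
  set T := ⌊100 * b * Y⌋₊ with hT_def
  have hT1 : (T : ℝ) ≤ 100 * b * Y := Nat.floor_le (by positivity)
  have hT2 : 100 * b * Y < T + 1 := Nat.lt_floor_add_one _
  have hbY : b * 1 ≤ b * Y := by gcongr; linarith
  have hTpos : (1 : ℝ) ≤ T := by linarith
  have hT3 : 3 + (T : ℝ) ≤ (k : ℝ) ^ 3 := by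
    have : 100 * b * Y ≤ 100 * b * (k * l ^ 2) := by gcongr
    linarith
  -- the total contention in a window of length `T`
  set S := ∑ i ∈ Finset.range T, transmitProb b (i + 1) with hS_def
  -- Since 3 + T ≤ k³, both logarithms in `sum_transmitProb_le` are at most 3l.
  have hS : S ≤ 12 * b * l ^ 2 := by
    have h1 : Real.log (3 + T) ≤ 3 * l := by
      have := Real.log_le_log (by linarith) hT3
      rw [Real.log_pow] at this
      exact_mod_cast this
    have h2 : Real.log T ≤ 3 * l :=
      (Real.log_le_log (by linarith) (by linarith)).trans h1
    calc S ≤ b * Real.log (3 + T) * (1 + Real.log T) := sum_transmitProb_le hb T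
      _ ≤ b * (3 * l) * (4 * l) := by
          have := Real.log_nonneg hTpos
          gcongr
          linarith
      _ = 12 * b * l ^ 2 := by ring
  have hhigh : k * S / (ll / 2) ≤ 24 * b * Y := by
    rw [div_le_iff₀ (by linarith)]
    calc k * S ≤ k * (12 * b * l ^ 2) := by gcongr
      _ = 12 * b * (k * l ^ 2) := by ring
      _ = 24 * b * Y * (ll / 2) := by rw [← hYeq]; ring
  -- the transmission probability in a window of length `T`
  have hprob : b * l / (2 * T) ≤ transmitProb b T := by
    obtain ⟨n, hn⟩ : ∃ n, T = n + 1 := ⟨T - 1, by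
      have : 1 ≤ T := by exact_mod_cast hTpos
      omega⟩
    have h1 : (T : ℝ) ≤ b * ((3 + n / b : ℕ) : ℝ) := by
      rw [hn]; exact_mod_cast succ_le_mul_three_add_div hb n
    have h2 : b * ((3 + n / b : ℕ) : ℝ) ≤ 2 * T := by
      have h3 : b * (n / b) ≤ n := Nat.mul_div_le n b
      have h4 : (b : ℝ) * ((n / b : ℕ) : ℝ) ≤ n := by exact_mod_cast h3
      have h5 : (T : ℝ) = n + 1 := by rw [hn]; push_cast; ring
      push_cast
      nlinarith
    rw [hn, transmitProb_succ, ← hn]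
    set J := ((3 + n / b : ℕ) : ℝ)
    have hkJ : k ≤ J := by
      have : (b : ℝ) * k ≤ b * J := by
        have : (b : ℝ) * k ≤ b * Y := by gcongr
        linarith
      exact le_of_mul_le_mul_left this (by linarith)
    have hlJ : l ≤ Real.log J := Real.log_le_log hk0 hkJ
    rw [div_le_div_iff₀ (by linarith) (by linarith)]
    calc b * l * J = l * (b * J) := by ring
      _ ≤ Real.log J * (2 * T) := mul_le_mul hlJ h2 (by positivity) (by linarith)
  -- the dichotomy
  set x := b * l / 4 * Real.exp (-(2 * 1)) with hx_def
  have hD : ∀ ω v w, Waits b adv ω v w T →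
      ω ∈ {ω | ∃ F : Finset ℕ, 4 * k * l ≤ F.card ∧ ∀ i ∈ F,
        1 < (run b adv ω i).contention b i ∧ (run b adv ω i).contention b i ≤ ll / 2} ∨
      ω ∈ {ω | ∃ w, Waits b adv ω v w T ∧ x ≤
        ∑ i ∈ (Finset.Ioc w (w + T)).filter fun i => (run b adv ω i).contention b i ≤ 1,
          transmitProb b (i - w) * Real.exp (-(2 * 1))} := by
    intro ω v w hW
    refine or_iff_not_imp_left.2 fun hF => ⟨w, hW, ?_⟩
    have hN : ∀ F : Finset ℕ, (∀ i ∈ F, 1 < (run b adv ω i).contention b i ∧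
        (run b adv ω i).contention b i ≤ ll / 2) → (F.card : ℝ) < 4 * k * l := fun F hF' =>
      lt_of_not_ge fun h => hF ⟨F, h, hF'⟩
    have hcard := card_low_contention b adv ω w T (θ := ll / 2) (by linarith) hN
    rw [← hS_def] at hcard
    set G := (Finset.Ioc w (w + T)).filter fun i => (run b adv ω i).contention b i ≤ 1
    -- Moderate and high rounds cost at most 4kl + 24bY ≤ 28bY, against T > 100bY - 1.
    have hG : (T : ℝ) / 2 ≤ G.card := by
      have hYb : 1 * Y ≤ b * Y := by gcongr
      nlinarith
    rw [← Finset.sum_mul]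
    refine mul_le_mul_of_nonneg_right ?_ (Real.exp_pos _).le
    calc b * l / 4 = T / 2 * (b * l / (2 * T)) := by
          field_simp
          norm_num
      _ ≤ G.card * transmitProb b T := by gcongr
      _ = ∑ _i ∈ G, transmitProb b T := by simp
      _ ≤ ∑ i ∈ G, transmitProb b (i - w) := by
          refine Finset.sum_le_sum fun i hi => ?_
          have hi' := Finset.mem_Ioc.1 (Finset.mem_filter.1 hi).1
          have h1 : T = (T - 1) + 1 := by omega
          have h2 : i - w = (i - w - 1) + 1 := by omega
          rw [h1, h2]
          exact transmitProb_succ_anti b (by omega)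
  have main := one_sub_le_prob_latencyAtMost b adv (hT1.trans hL) _ _ hD
    (prob_moderate_rounds_le b adv (ll / 2) (4 * k * l)) fun v => prob_waits_le b adv v 1 T x
  refine le_trans (sub_le_sub_left ?_ 1) main
  -- The threshold θ = ll/2 makes exp(-2θ) = 1/l, so the exponent is exactly k - 2k = -k.
  have h1 : Real.exp (k - Real.exp (-(2 * (ll / 2))) / 2 * (4 * k * l)) ≤
      1 / 2 * (1 / (k : ℝ) ^ η) := by
    refine le_trans (le_of_eq ?_) hexp
    congr 1
    rw [mul_div_cancel₀ _ two_ne_zero, Real.exp_neg, hll_def, Real.exp_log (by linarith)]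
    field_simp
    ring
  have h2 : k * Real.exp (-x) ≤ 1 / 2 * (1 / (k : ℝ) ^ η) := by
    -- Here exp(-2) ≥ 1/8 turns bl/4 into bl/32, which is the source of the constant 32. One unit of
    -- η + 2 pays for the union bound, the other for the factor 1/2.
    have hx : (η + 2) * l ≤ x := by
      have he : 1 / 8 ≤ Real.exp (-(2 * 1)) := by
        rw [Real.exp_neg, ← one_div]
        refine one_div_le_one_div_of_le (Real.exp_pos _) ?_
        rw [two_mul, Real.exp_add]
        have := Real.exp_one_lt_d9
        nlinarith [Real.exp_pos 1]
      calc (η + 2) * l ≤ b / 32 * l := by gcongr; linarith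
        _ = b * l / 4 * (1 / 8) := by ring
        _ ≤ x := by rw [hx_def]; gcongr
    have hexpl : (k : ℝ) = Real.exp l := (Real.exp_log hk0).symm
    calc k * Real.exp (-x) ≤ k * Real.exp (-((η + 2) * l)) := by gcongr
      _ = Real.exp (-l) * Real.exp (-(l * η)) := by
          rw [hexpl, ← Real.exp_add, ← Real.exp_add]
          congr 1
          ring
      _ ≤ 1 / 2 * Real.exp (-(l * η)) := by
          gcongr
          rw [Real.exp_neg, ← hexpl, ← one_div]
          exact one_div_le_one_div_of_le two_pos hk1
      _ = _ := by rw [Real.rpow_def_of_pos hk0, Real.exp_neg, one_div ((Real.exp _))]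
  linarith

end ContentionResolution

open ContentionResolution in
theorem theorem5p2 (η : ℝ) (hη : 0 < η) :
    ∃ b₀ : ℕ, ∀ b : ℕ, b₀ ≤ b → ∃ C : ℝ, 0 < C ∧
      ∀ k : ℕ, 3 ≤ k → ∀ adv : ContentionResolution.Adversary k,
        1 - 1 / (k : ℝ) ^ η ≤
          (ContentionResolution.coins k).real
            {ω | ContentionResolution.LatencyAtMost b adv ω
              (C * ((k : ℝ) * Real.log k ^ 2 / Real.log (Real.log k)))} := by
  refine ⟨⌈32 * (η + 2)⌉₊, fun b hb => ?_⟩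
  have hbη : 32 * (η + 2) ≤ b := Nat.ceil_le.1 hb
  have hb1 : 1 ≤ b := by
    have : (0 : ℝ) < b := by linarith
    exact_mod_cast this
  obtain ⟨K, hK⟩ := Filter.eventually_atTop.1 (eventually_parameters η (100 * b))
  have hsmall : ∀ k : ℕ, ∃ T : ℕ, 3 ≤ k → ∀ L : ℝ, T ≤ L → ∀ adv : Adversary k,
      1 - 1 / (k : ℝ) ^ η ≤ (coins k).real {ω | LatencyAtMost b adv ω L} := fun k => by
    by_cases hk : 3 ≤ k
    · obtain ⟨T, hT⟩ := exists_latency_bound b η (show 1 ≤ k by omega)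
      exact ⟨T, fun _ => hT⟩
    · exact ⟨0, fun h => absurd h hk⟩
  choose T hT using hsmall
  -- The sum dominates T k / `latencyScale k` for every k from 3 to K - 1; the absolute value keeps
  -- the irrelevant terms i < 3 nonnegative.
  have hnonneg : ∀ i ∈ Finset.range K, 0 ≤ (T i : ℝ) / |latencyScale i| := fun i _ => by
    positivity
  have hsum := Finset.sum_nonneg hnonneg
  have hb0 : (0 : ℝ) < b := by linarith
  refine ⟨100 * b + ∑ i ∈ Finset.range K, (T i : ℝ) / |latencyScale i|, by positivity,
    fun k hk adv => ?_⟩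
  have hY := latencyScale_pos hk
  rcases lt_or_ge k K with hkK | hkK
  · refine hT k hk _ ?_ adv
    have h1 := Finset.single_le_sum hnonneg (Finset.mem_range.2 hkK)
    rw [abs_of_pos hY, div_le_iff₀ hY] at h1
    refine h1.trans (mul_le_mul_of_nonneg_right ?_ hY.le)
    linarith
  · obtain ⟨h1, h2, h3, h4⟩ := hK k hkK
    refine prob_latencyAtMost_of_large hb1 hbη h1 h2 h3 h4 adv ?_
    exact mul_le_mul_of_nonneg_right (by linarith) hY.le
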